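/- For $n\ge 1$ and a binary polynomial $A(X)=\sum_{i=0}^{n-1}a_iX^i\in\mathbb F_2[X]$ let $\mathrm{Circ}(A,n)$ be the $n\times n$ circulant matrix over $\mathbb F_2$ whose entry in row $i$ and column $j$ is $a_{(i-j)\bmod n}$. For two such polynomials $A,B$, the generalized bicycle code $GB(A,B,n)$ is the CSS quantum code on $2n$ qubits with stabilizer generator matrices $H_X=[\mathbf A,\mathbf B]$ and $H_Z=[\mathbf B^{\intercal},\mathbf A^{\intercal}]$, where $\mathbf A=\mathrm{Circ}(A,n)$ and $\mathbf B=\mathrm{Circ}(B,n)$; that is, the space of all states in $(\mathbb C^2)^{\otimes 2n}$ fixed by the Pauli operators $X^{u}$ for every row $u$ of $H_X$ and $Z^{v}$ for every row $v$ of $H_Z$. A CSS code with generator matrices $H_X,H_Z$ has parameters $[[N,k,d]]$ if $N$ is its number of qubits, its code space has dimension $2^k$, where $k=N-\operatorname{rank}H_X-\operatorname{rank}H_Z$, and $d=\min(d_X,d_Z)$, where $d_X$ is the smallest Hamming weight of a vector of $\ker H_X$ that is not in the row space of $H_Z$, and $d_Z$ is the smallest Hamming weight of a vector of $\ker H_Z$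 that is not in the row space of $H_X$. Proposition. Let $n\ge 2$, $r\ge 1$ and $t\ge 1$ be integers. Then: 1. $GB(1+X,\,1+X^{n},\,n^2)$ has parameters $[[2n^2,\,2,\,n]]$; 2. $GB(1+X,\,1+X^{2r-1},\,2r^2)$ has parameters $[[4r^2,\,2,\,2r]]$; 3. $GB(1+X,\,1+X^{2t+1},\,t^2+(t+1)^2)$ has parameters $[[(2t+1)^2+1,\,2,\,2t+1]]$. -/

import Mathlib

open Polynomial

/-- A CSS code with qubits indexed by `q` and stabilizer generators of each of the two types indexed
by `m`: two binary matrices with orthogonal row spaces. The rows of `HX` give generators that are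
products of Pauli `X` operators, those of `HZ` give products of Pauli `Z` operators. -/
structure CSSCode (q m : Type*) [Fintype q] where
  HX : Matrix m q (ZMod 2)
  HZ : Matrix m q (ZMod 2)
  orthogonal : HX * HZ.transpose = 0

/-- The row space of a binary matrix. -/
def rowSpace {q m : Type*} (H : Matrix m q (ZMod 2)) : Submodule (ZMod 2) (q → ZMod 2) :=
  Submodule.span (ZMod 2) (Set.range fun i => H i)

/-- The state space `(ℂ²)^{⊗ q}` in coordinates: `ψ t` is the amplitude of the computational basis
vector `|t⟩`, for a bit string `t`. -/
abbrev QubitState (q : Type*) : Type _ := (q → ZMod 2) → ℂ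

/-- The operator `X^u`, determined by `X^u |t⟩ = |t + u⟩`. -/
def pauliX {q : Type*} (u : q → ZMod 2) : Module.End ℂ (QubitState q) where
  toFun ψ := fun t => ψ (t + u)
  map_add' _ _ := rfl
  map_smul' _ _ := rfl

/-- The operator `Z^v`, determined by `Z^v |t⟩ = (-1)^{v · t} |t⟩`. -/
def pauliZ {q : Type*} [Fintype q] (v : q → ZMod 2) : Module.End ℂ (QubitState q) where
  toFun ψ := fun t => (-1 : ℂ) ^ (dotProduct v t).val * ψ t
  map_add' ψ φ := by
    funext t
    simp [mul_add]
  map_smul' c ψ := by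
    funext t
    simp [mul_left_comm]

namespace CSSCode

variable {q m : Type*} [Fintype q]

/-- The stabilizer group: all products of generators. (The generators are involutions, so the
monoid that they generate is a group.) -/
def stabilizer (Q : CSSCode q m) : Submonoid (Module.End ℂ (QubitState q)) :=
  Submonoid.closure
    ((Set.range fun i => pauliX (Q.HX i)) ∪ (Set.range fun i => pauliZ (Q.HZ i)))

/-- The quantum code itself: the states fixed by every element of the stabilizer group. -/
def codeSpace (Q : CSSCode q m) : Submodule ℂ (QubitState q) where
  carrier := {ψ | ∀ S ∈ Q.stabilizer, S ψ = ψ}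
  add_mem' := by
    intro ψ φ hψ hφ S hS
    rw [map_add, hψ S hS, hφ S hS]
  zero_mem' := by
    intro S _
    exact map_zero S
  smul_mem' := by
    intro c ψ hψ S hS
    rw [map_smul, hψ S hS]

/-- `d_X`: the smallest Hamming weight of a vector of `ker HX` outside the row space of `HZ`
(`⊤` if there is none). -/
noncomputable def distX (Q : CSSCode q m) : ℕ∞ :=
  ⨅ c ∈ {c : q → ZMod 2 | Q.HX.mulVec c = 0 ∧ c ∉ rowSpace Q.HZ}, (hammingNorm c : ℕ∞)

/-- `d_Z`: the smallest Hamming weight of a vector of `ker HZ` outside the row space of `HX`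
(`⊤` if there is none). -/
noncomputable def distZ (Q : CSSCode q m) : ℕ∞ :=
  ⨅ c ∈ {c : q → ZMod 2 | Q.HZ.mulVec c = 0 ∧ c ∉ rowSpace Q.HX}, (hammingNorm c : ℕ∞)

/-- The minimum distance of a CSS code. -/
noncomputable def minDist (Q : CSSCode q m) : ℕ∞ := min Q.distX Q.distZ

/-- `Q` has parameters `[[N, k, d]]`: there are `N` physical qubits, the code space has dimension
`2 ^ k`, where also `k = N - rank HX - rank HZ`, and the minimum distance is `d`. -/
structure HasParameters (Q : CSSCode q m) (N k d : ℕ) : Prop where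
  length : Fintype.card q = N
  dimension : Module.finrank ℂ Q.codeSpace = 2 ^ k
  logical : k + Q.HX.rank + Q.HZ.rank = N
  distance : Q.minDist = d

end CSSCode

/-- The `n × n` circulant matrix of a binary polynomial `A` of degree at most `n - 1`: the entry in
row `i` and column `j` is the coefficient of `A` of index `i - j` modulo `n`. -/
def circ (A : (ZMod 2)[X]) (n : ℕ) : Matrix (Fin n) (Fin n) (ZMod 2) :=
  Matrix.circulant fun i : Fin n => A.coeff (i : ℕ)

theorem circ_mul_comm (A B : (ZMod 2)[X]) (n : ℕ) :
    circ A n * circ B n = circ B n * circ A n := by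
  cases n with
  | zero => exact Subsingleton.elim _ _
  | succ n => exact Matrix.circulant_mul_comm _ _

/-- The generalized bicycle code `GB(A, B, n)`, for binary polynomials of degree at most `n - 1`. -/
def GB (A B : (ZMod 2)[X]) (n : ℕ) : CSSCode (Fin n ⊕ Fin n) (Fin n) where
  HX := Matrix.fromCols (circ A n) (circ B n)
  HZ := Matrix.fromCols (circ B n).transpose (circ A n).transpose
  orthogonal := by
    rw [Matrix.transpose_fromCols, Matrix.fromCols_mul_fromRows, Matrix.transpose_transpose,
      Matrix.transpose_transpose, circ_mul_comm B A n]
    ext i j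
    exact CharTwo.add_self_eq_zero _

/-! The code `GB(1 + X, 1 + X ^ m, N)` is a toric code. Its torus has vertex set `ℤ/N`, edges `i → i
+ 1` (left qubits) and `i → i + m` (right qubits), and one square at each vertex. `HX` is the
boundary map on edge chains and `HZ` tests closedness of cochains around squares; the rows of `HX`
span the coboundaries, those of `HZ` the boundaries. Each matrix has rank `N - 1`, which leaves two
logical qubits. The symmetry `i ↦ -i`, combined with a swap of the two kinds of edges, identifies
the two distances.

Upper bound: `P` steps of length `1` and `Q` of length `m` with `P + m * Q = N` close up to a
nontrivial cycle (`HX_mulVec_path`).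

Lower bound: if a cocycle `z` pairs oddly with a cycle `c`, so do all `N` translates of `z`, since
they are cohomologous (`dotProduct_translate`). Hence every translate meets the support of `c`. If
`z` has at most `w` entries of each kind, an edge lies in at most `w` translates, so `N ≤ w * |c|`
(`card_le_mul_hammingNorm`). Cocycles with small `w` are the jumps mod 2 of `x ↦ ⌊q x / N⌋`. Two of
them with odd determinant detect every nontrivial class, and each family needs only a good choice of
these two. -/

/-! ### Row spaces over `ZMod 2` -/

theorem finrank_rowSpace {q m : Type*} [Fintype q] [Finite m] (H : Matrix m q (ZMod 2)) :
    Module.finrank (ZMod 2) (rowSpace H) = H.rank := by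
  rw [Matrix.rank_eq_finrank_span_row]
  rfl

theorem dotProduct_eq_zero_of_mem_rowSpace {q m : Type*} [Fintype q] {H : Matrix m q (ZMod 2)}
    {c z : q → ZMod 2} (hc : H.mulVec c = 0) (hz : z ∈ rowSpace H) : dotProduct z c = 0 := by
  induction hz using Submodule.span_induction with
  | mem x hx =>
    obtain ⟨i, rfl⟩ := hx
    exact congrFun hc i
  | zero => simp
  | add x y _ _ hx hy => rw [add_dotProduct, hx, hy, add_zero]
  | smul a x _ hx => rw [smul_dotProduct, hx, smul_zero]

theorem vecMul_mem_rowSpace {q m : Type*} [Fintype q] [Fintype m] (H : Matrix m q (ZMod 2))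
    (f : m → ZMod 2) : H.vecMul f ∈ rowSpace H := by
  rw [Matrix.vecMul_eq_sum]
  exact Submodule.sum_mem _ fun i _ => Submodule.smul_mem _ _ (Submodule.subset_span ⟨i, rfl⟩)

theorem mem_rowSpace_submatrix {q q' m m' : Type*} [Fintype q] [Fintype q']
    (H : Matrix m q (ZMod 2)) (e : m' ≃ m) (σ : q' ≃ q) {c : q → ZMod 2} (hc : c ∈ rowSpace H) :
    c ∘ σ ∈ rowSpace (H.submatrix e σ) := by
  have h : rowSpace H ≤
      (rowSpace (H.submatrix e σ)).comap (LinearMap.funLeft (ZMod 2) (ZMod 2) σ) := by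
    refine Submodule.span_le.2 ?_
    rintro _ ⟨i, rfl⟩
    refine Submodule.subset_span ⟨e.symm i, ?_⟩
    ext j
    simp [LinearMap.funLeft]
  exact h hc

theorem hammingNorm_comp_equiv {q q' : Type*} [Fintype q] [Fintype q'] (c : q → ZMod 2)
    (σ : q' ≃ q) : hammingNorm (c ∘ σ) = hammingNorm c := by
  unfold hammingNorm
  exact Finset.card_equiv σ (by simp)

/-! ### Dimension and distance of CSS codes -/

namespace CSSCode

variable {q m : Type*} [Fintype q]

/-- Fixing the generators suffices. A `Z` generator acts by a sign on each amplitude, so it fixes a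
state exactly when the amplitudes with sign `-1` vanish. -/
theorem mem_codeSpace_iff (Q : CSSCode q m) (ψ : QubitState q) :
    ψ ∈ Q.codeSpace ↔ (∀ i t, ψ (t + Q.HX i) = ψ t) ∧
      ∀ i t, dotProduct (Q.HZ i) t ≠ 0 → ψ t = 0 := by
  have hval : ∀ a : ZMod 2, a ≠ 0 → a.val = 1 := by decide
  constructor
  · intro h
    refine ⟨fun i t => congrFun (h _ (Submonoid.subset_closure (Or.inl ⟨i, rfl⟩))) t,
      fun i t ht => ?_⟩
    have h1 : (-1 : ℂ) ^ (dotProduct (Q.HZ i) t).val * ψ t = ψ t :=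
      congrFun (h _ (Submonoid.subset_closure (Or.inr ⟨i, rfl⟩))) t
    rw [hval _ ht] at h1
    linear_combination (-1 / 2 : ℂ) * h1
  · rintro ⟨h1, h2⟩ S hS
    induction hS using Submonoid.closure_induction with
    | mem x hx =>
      rcases hx with ⟨i, rfl⟩ | ⟨i, rfl⟩
      · exact funext fun t => h1 i t
      · funext t
        change (-1 : ℂ) ^ (dotProduct (Q.HZ i) t).val * ψ t = ψ t
        by_cases ht : dotProduct (Q.HZ i) t = 0
        · simp [ht]
        · simp [h2 i t ht]
    | one => rfl
    | mul x y _ _ hx hy => rw [Module.End.mul_apply, hy, hx]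

theorem rowSpace_HX_le_ker (Q : CSSCode q m) :
    rowSpace Q.HX ≤ LinearMap.ker Q.HZ.mulVecLin := by
  refine Submodule.span_le.2 ?_
  rintro _ ⟨i, rfl⟩
  change Q.HZ.mulVec (Q.HX i) = 0
  ext j
  have := congrFun (congrFun Q.orthogonal i) j
  rw [Matrix.mul_apply] at this
  rw [Matrix.mulVec, dotProduct_comm]
  exact this

theorem rowSpace_HZ_le_ker (Q : CSSCode q m) :
    rowSpace Q.HZ ≤ LinearMap.ker Q.HX.mulVecLin := by
  refine Submodule.span_le.2 ?_
  rintro _ ⟨i, rfl⟩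
  change Q.HX.mulVec (Q.HZ i) = 0
  ext j
  exact congrFun (congrFun Q.orthogonal j) i

/-- The `X`-type operators commuting with the stabilizer, modulo the stabilizer. -/
abbrev LogicalX (Q : CSSCode q m) : Type _ :=
  LinearMap.ker Q.HZ.mulVecLin ⧸ (rowSpace Q.HX).submoduleOf (LinearMap.ker Q.HZ.mulVecLin)

theorem apply_add_of_mem_codeSpace (Q : CSSCode q m) {ψ : QubitState q} (hψ : ψ ∈ Q.codeSpace)
    {u : q → ZMod 2} (hu : u ∈ rowSpace Q.HX) (t : q → ZMod 2) : ψ (t + u) = ψ t := by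
  induction hu using Submodule.span_induction generalizing t with
  | mem x hx =>
    obtain ⟨i, rfl⟩ := hx
    exact ((Q.mem_codeSpace_iff ψ).1 hψ).1 i t
  | zero => simp
  | add x y _ _ hx hy => rw [← add_assoc, hy, hx]
  | smul a x _ hx =>
    have ha : a = 0 ∨ a = 1 := by revert a; decide
    rcases ha with rfl | rfl
    · simp
    · simpa using hx t

open Classical in
/-- A code state is a function on the cosets of the row space of `HX` in the kernel of `HZ`. -/
noncomputable def codeSpaceEquiv (Q : CSSCode q m) : Q.codeSpace ≃ₗ[ℂ] (Q.LogicalX → ℂ) where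
  toFun ψ := Quotient.lift (fun t : LinearMap.ker Q.HZ.mulVecLin => ψ.1 t.1) (by
    intro s t hst
    have h : s - t ∈ (rowSpace Q.HX).submoduleOf (LinearMap.ker Q.HZ.mulVecLin) :=
      (Submodule.quotientRel_def _).1 hst
    have h' : s.1 - t.1 ∈ rowSpace Q.HX := h
    have := Q.apply_add_of_mem_codeSpace ψ.2 h' t.1
    rwa [add_sub_cancel] at this)
  map_add' ψ φ := by
    funext x
    induction x using Quotient.inductionOn
    rfl
  map_smul' a ψ := by
    funext x
    induction x using Quotient.inductionOn
    rfl
  -- Extension by zero is forced: the `Z` checks kill every amplitude outside the kernel.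
  invFun g := ⟨fun t => if h : t ∈ LinearMap.ker Q.HZ.mulVecLin then
      g (Submodule.Quotient.mk ⟨t, h⟩) else 0, by
    rw [mem_codeSpace_iff]
    constructor
    · intro i t
      have hi : Q.HX i ∈ rowSpace Q.HX := Submodule.subset_span ⟨i, rfl⟩
      have hi' := Q.rowSpace_HX_le_ker hi
      by_cases ht : t ∈ LinearMap.ker Q.HZ.mulVecLin
      · have ht' := Submodule.add_mem _ ht hi'
        simp only [dif_pos ht, dif_pos ht']
        congr 1
        rw [Submodule.Quotient.eq]
        change t + Q.HX i - t ∈ rowSpace Q.HX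
        rwa [add_sub_cancel_left]
      · have ht' : t + Q.HX i ∉ LinearMap.ker Q.HZ.mulVecLin := fun h =>
          ht (by simpa using Submodule.sub_mem _ h hi')
        simp only [dif_neg ht, dif_neg ht']
    · intro i t ht
      exact dif_neg fun h => ht (congrFun (LinearMap.mem_ker.1 h) i)⟩
  left_inv ψ := by
    refine Subtype.ext (funext fun t => ?_)
    by_cases ht : t ∈ LinearMap.ker Q.HZ.mulVecLin
    · simp only [dif_pos ht]
      rfl
    · simp only [dif_neg ht]
      by_contra h
      refine ht (LinearMap.mem_ker.2 (funext fun i => ?_))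
      by_contra hi
      exact h (((Q.mem_codeSpace_iff ψ.1).1 ψ.2).2 i t hi).symm
  right_inv g := by
    funext x
    induction x using Quotient.inductionOn with
    | h t => exact dif_pos t.2

theorem finrank_LogicalX [Fintype m] (Q : CSSCode q m) {k : ℕ}
    (h : k + Q.HX.rank + Q.HZ.rank = Fintype.card q) :
    Module.finrank (ZMod 2) Q.LogicalX = k := by
  have h1 := Submodule.finrank_quotient_add_finrank
    ((rowSpace Q.HX).submoduleOf (LinearMap.ker Q.HZ.mulVecLin))
  have h2 := LinearMap.finrank_range_add_finrank_ker Q.HZ.mulVecLin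
  have h3 := (Submodule.submoduleOfEquivOfLe Q.rowSpace_HX_le_ker).finrank_eq
  rw [finrank_rowSpace] at h3
  rw [Module.finrank_fintype_fun_eq_card] at h2
  change Q.HZ.rank + _ = _ at h2
  unfold LogicalX
  omega

theorem finrank_codeSpace [Fintype m] (Q : CSSCode q m) {k : ℕ}
    (h : k + Q.HX.rank + Q.HZ.rank = Fintype.card q) :
    Module.finrank ℂ Q.codeSpace = 2 ^ k := by
  classical
  have : Finite Q.LogicalX := Quotient.finite _
  have : Fintype Q.LogicalX := Fintype.ofFinite _
  rw [Q.codeSpaceEquiv.finrank_eq, Module.finrank_fintype_fun_eq_card,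
    Module.card_eq_pow_finrank (K := ZMod 2), Q.finrank_LogicalX h, ZMod.card]

/-- Two functionals that vanish on the row space of `HZ` and separate a quotient of dimension two
detect membership in that row space. -/
theorem mem_rowSpace_HZ_of_dotProduct_eq_zero [Fintype m] (Q : CSSCode q m)
    (h : 2 + Q.HX.rank + Q.HZ.rank = Fintype.card q) {z₁ z₂ : q → ZMod 2}
    (h₁ : Q.HZ.mulVec z₁ = 0) (h₂ : Q.HZ.mulVec z₂ = 0)
    (hsurj : ∀ a b : ZMod 2, ∃ c, Q.HX.mulVec c = 0 ∧ dotProduct c z₁ = a ∧ dotProduct c z₂ = b)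
    {c : q → ZMod 2} (hc : Q.HX.mulVec c = 0) (hc₁ : dotProduct c z₁ = 0)
    (hc₂ : dotProduct c z₂ = 0) : c ∈ rowSpace Q.HZ := by
  classical
  let K := LinearMap.ker Q.HX.mulVecLin
  let φ (z : q → ZMod 2) : (q → ZMod 2) →ₗ[ZMod 2] ZMod 2 :=
    { toFun := fun c => dotProduct c z
      map_add' := fun a b => add_dotProduct a b z
      map_smul' := fun a b => smul_dotProduct a b z }
  let Φ : K →ₗ[ZMod 2] ZMod 2 × ZMod 2 := ((φ z₁).prod (φ z₂)).domRestrict K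
  have hΦ : LinearMap.range Φ = ⊤ := by
    rw [LinearMap.range_eq_top]
    rintro ⟨a, b⟩
    obtain ⟨c, hc, ha, hb⟩ := hsurj a b
    exact ⟨⟨c, hc⟩, Prod.ext ha hb⟩
  have hle : (rowSpace Q.HZ).submoduleOf K ≤ LinearMap.ker Φ := by
    intro x hx
    exact LinearMap.mem_ker.2 (Prod.ext (dotProduct_eq_zero_of_mem_rowSpace h₁ hx)
      (dotProduct_eq_zero_of_mem_rowSpace h₂ hx))
  have e1 := LinearMap.finrank_range_add_finrank_ker Φ
  have e2 := LinearMap.finrank_range_add_finrank_ker Q.HX.mulVecLin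
  have e3 := (Submodule.submoduleOfEquivOfLe Q.rowSpace_HZ_le_ker).finrank_eq
  rw [finrank_rowSpace] at e3
  rw [Module.finrank_fintype_fun_eq_card] at e2
  change Q.HX.rank + Module.finrank _ K = _ at e2
  change Module.finrank _ ((rowSpace Q.HZ).submoduleOf K) = _ at e3
  rw [hΦ, finrank_top, Module.finrank_prod, Module.finrank_self] at e1
  -- Both sides have dimension `rank HZ`: the kernel of `HX` has dimension `2 + rank HZ`, and `Φ`
  -- maps it onto a plane.
  have heq := Submodule.eq_of_le_of_finrank_eq hle (by omega)
  have hmem : (⟨c, hc⟩ : K) ∈ LinearMap.ker Φ := LinearMap.mem_ker.2 (Prod.ext hc₁ hc₂)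
  rw [← heq] at hmem
  exact hmem

/-- A permutation of the qubits that exchanges the two kinds of checks exchanges the two
distances. -/
theorem distZ_eq_distX (Q : CSSCode q m) (e : m ≃ m) (σ : q ≃ q)
    (hX : Q.HX = Q.HZ.submatrix e σ) (hZ : Q.HZ = Q.HX.submatrix e σ) : Q.distZ = Q.distX := by
  have key : ∀ H H' : Matrix m q (ZMod 2), H = H'.submatrix e σ → H' = H.submatrix e σ →
      (⨅ c ∈ {c : q → ZMod 2 | H'.mulVec c = 0 ∧ c ∉ rowSpace H}, (hammingNorm c : ℕ∞)) ≤
      ⨅ c ∈ {c : q → ZMod 2 | H.mulVec c = 0 ∧ c ∉ rowSpace H'}, (hammingNorm c : ℕ∞) := by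
    intro H H' h h'
    refine le_iInf₂ fun c hc => ?_
    have hc' : c ∘ σ.symm ∈ {c : q → ZMod 2 | H'.mulVec c = 0 ∧ c ∉ rowSpace H} := by
      constructor
      · have h1 := hc.1
        rw [h, Matrix.submatrix_mulVec_equiv] at h1
        ext i
        simpa using congrFun h1 (e.symm i)
      · intro hmem
        refine hc.2 ?_
        have := mem_rowSpace_submatrix H e σ hmem
        rw [← h'] at this
        simpa [Function.comp_def] using this
    refine (iInf₂_le _ hc').trans ?_
    rw [hammingNorm_comp_equiv]
  exact le_antisymm (key _ _ hX hZ) (key _ _ hZ hX)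

theorem distX_eq (Q : CSSCode q m) {d : ℕ} (c : q → ZMod 2) (hc : Q.HX.mulVec c = 0)
    (hc' : c ∉ rowSpace Q.HZ) (hcd : hammingNorm c ≤ d)
    (h : ∀ c, Q.HX.mulVec c = 0 → c ∉ rowSpace Q.HZ → d ≤ hammingNorm c) : Q.distX = d := by
  refine le_antisymm ((iInf₂_le c ⟨hc, hc'⟩).trans (by exact_mod_cast hcd)) ?_
  exact le_iInf₂ fun c hc => by exact_mod_cast h c hc.1 hc.2

end CSSCode

/-! ### Boundary and coboundary maps of the torus -/

namespace GB

/-- The code `GB(1 + X, 1 + X ^ m, N)`. -/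
noncomputable abbrev binomialCode (m N : ℕ) : CSSCode (Fin N ⊕ Fin N) (Fin N) :=
  GB (1 + X) (1 + X ^ m) N

/-- A step of length `s` splits into `s` unit steps, and each of these telescopes over a period to
`a`. -/
theorem sum_apply_add_sub {N : ℕ} {f : ℤ → ℤ} {a : ℤ} (hf : ∀ x, f (x + N) = f x + a) (s : ℕ) :
    ∑ x ∈ Finset.range N, (f (x + s) - f x) = s * a := by
  induction s with
  | zero => simp
  | succ s ih =>
    have h : ∑ x ∈ Finset.range N, (f (x + (s + 1 : ℕ)) - f (x + s)) = a := by
      have := Finset.sum_range_sub (fun x : ℕ => f (x + s)) N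
      rw [show ((N : ℕ) : ℤ) + s = s + N by ring, hf] at this
      simp only [Nat.cast_add, Nat.cast_one, Nat.cast_zero, zero_add] at this ⊢
      rw [add_sub_cancel_left] at this
      rw [← this]
      exact Finset.sum_congr rfl fun x _ => by congr 2; ring
    have hs : ((s + 1 : ℕ) : ℤ) * a = a + s * a := by push_cast; ring
    rw [hs, ← ih]
    conv_rhs => rw [← h]
    rw [← Finset.sum_add_distrib]
    exact Finset.sum_congr rfl fun x _ => by ring

variable {m N : ℕ} [NeZero N]

theorem circ_one_add_X_pow_apply (hmN : m < N) (i j : Fin N) :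
    circ (1 + X ^ m) N i j =
      (if j = i then 1 else 0) + if j = i - Fin.ofNat N m then 1 else 0 := by
  have h1 : j = i ↔ ((i - j : Fin N) : ℕ) = 0 := by
    rw [Fin.val_eq_zero_iff, sub_eq_zero, eq_comm]
  have h2 : j = i - Fin.ofNat N m ↔ ((i - j : Fin N) : ℕ) = m := by
    have : ((Fin.ofNat N m : Fin N) : ℕ) = m := Nat.mod_eq_of_lt hmN
    conv_rhs => rw [← this]
    rw [Fin.val_inj, sub_eq_iff_eq_add, eq_sub_iff_add_eq, add_comm, eq_comm]
  simp only [circ, Matrix.circulant_apply, coeff_add, coeff_one, coeff_X_pow, h1, h2]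

theorem circ_one_add_X_apply (hN : 2 ≤ N) (i j : Fin N) :
    circ (1 + X) N i j =
      (if j = i then 1 else 0) + if j = i - Fin.ofNat N 1 then 1 else 0 := by
  simpa using circ_one_add_X_pow_apply (m := 1) hN i j

theorem HX_mulVec (hm : 1 ≤ m) (hmN : m < N) (c : Fin N ⊕ Fin N → ZMod 2) (i : Fin N) :
    (binomialCode m N).HX.mulVec c i = (c (.inl i) + c (.inl (i - Fin.ofNat N 1))) +
      (c (.inr i) + c (.inr (i - Fin.ofNat N m))) := by
  simp only [GB, Matrix.mulVec, dotProduct, Fintype.sum_sum_type, Matrix.fromCols_apply_inl,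
    Matrix.fromCols_apply_inr, circ_one_add_X_pow_apply hmN,
    circ_one_add_X_apply (lt_of_le_of_lt hm hmN), add_mul, ite_mul, one_mul, zero_mul,
    Finset.sum_add_distrib, Finset.sum_ite_eq', Finset.mem_univ, if_true]

/-- Inversion in the cyclic group transposes a circulant matrix; the swap of the halves exchanges
the two polynomials. -/
theorem HZ_eq_submatrix :
    (binomialCode m N).HZ =
      (binomialCode m N).HX.submatrix (Equiv.neg _)
        ((Equiv.sumComm _ _).trans ((Equiv.neg _).sumCongr (Equiv.neg _))) := by
  ext i j
  rcases j with j | j <;>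
    simp [GB, circ, Matrix.circulant_apply, neg_add_eq_sub]

theorem HX_eq_submatrix :
    (binomialCode m N).HX =
      (binomialCode m N).HZ.submatrix (Equiv.neg _)
        ((Equiv.sumComm _ _).trans ((Equiv.neg _).sumCongr (Equiv.neg _))) := by
  ext i j
  rcases j with j | j <;>
    simp [GB, circ, Matrix.circulant_apply, neg_add_eq_sub]

theorem HZ_mulVec (hm : 1 ≤ m) (hmN : m < N) (z : Fin N ⊕ Fin N → ZMod 2) (i : Fin N) :
    (binomialCode m N).HZ.mulVec z i = (z (.inl i) + z (.inl (i + Fin.ofNat N m))) +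
      (z (.inr i) + z (.inr (i + Fin.ofNat N 1))) := by
  rw [HZ_eq_submatrix, Matrix.submatrix_mulVec_equiv]
  simp only [Function.comp_apply, HX_mulVec hm hmN, Equiv.neg_apply]
  simp [Equiv.neg_symm, neg_sub, add_comm]

theorem vecMul_HX (hm : 1 ≤ m) (hmN : m < N) (f : Fin N → ZMod 2) :
    (binomialCode m N).HX.vecMul f =
      Sum.elim (fun i => f i + f (i + Fin.ofNat N 1)) fun i => f i + f (i + Fin.ofNat N m) := by
  have key : ∀ k : ℕ, ∀ j : Fin N, ∑ i : Fin N, f i *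
      ((if j = i then 1 else 0) + if j = i - Fin.ofNat N k then 1 else 0) =
      f j + f (j + Fin.ofNat N k) := by
    intro k j
    simp [mul_add, Finset.sum_add_distrib, eq_sub_iff_add_eq]
  ext j
  rcases j with j | j
  · simp only [GB, Matrix.vecMul, dotProduct, Matrix.fromCols_apply_inl,
      circ_one_add_X_apply (lt_of_le_of_lt hm hmN), Sum.elim_inl]
    exact key 1 j
  · simp only [GB, Matrix.vecMul, dotProduct, Matrix.fromCols_apply_inr,
      circ_one_add_X_pow_apply hmN, Sum.elim_inr]
    exact key m j

theorem ofNat_add (j k : ℕ) : Fin.ofNat N (j + k) = Fin.ofNat N j + Fin.ofNat N k := by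
  ext
  simp [Fin.val_add]

theorem induction_ofNat {p : Fin N → Prop} (h0 : p 0) (h : ∀ i, p i → p (i + Fin.ofNat N 1))
    (i : Fin N) : p i := by
  have : ∀ k : ℕ, p (Fin.ofNat N k) := by
    intro k
    induction k with
    | zero => simpa using h0
    | succ k ih => rw [ofNat_add]; exact h _ ih
  simpa using this i

/-- The graph is connected through steps of length `1`, so only constant functions have zero
coboundary. -/
theorem rank_HX (hm : 1 ≤ m) (hmN : m < N) : (binomialCode m N).HX.rank + 1 = N := by
  rw [← Matrix.rank_transpose]
  have h := LinearMap.finrank_range_add_finrank_ker (binomialCode m N).HX.transpose.mulVecLin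
  have hker : LinearMap.ker (binomialCode m N).HX.transpose.mulVecLin =
      Submodule.span (ZMod 2) {fun _ => 1} := by
    ext f
    rw [LinearMap.mem_ker, Matrix.mulVecLin_apply, Matrix.mulVec_transpose, vecMul_HX hm hmN,
      Submodule.mem_span_singleton]
    constructor
    · intro hf
      refine ⟨f 0, funext fun i => ?_⟩
      have : f i = f 0 := induction_ofNat (p := fun i => f i = f 0) rfl (fun i hi => by
        have := congrFun hf (.inl i)
        rw [← hi]
        exact (CharTwo.add_eq_zero.1 this).symm) i
      simp [this]
    · rintro ⟨a, rfl⟩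
      ext i
      rcases i with i | i <;> simp [CharTwo.add_self_eq_zero]
  rw [hker, finrank_span_singleton (by
    intro h0
    exact one_ne_zero (congrFun h0 (0 : Fin N))), Module.finrank_fintype_fun_eq_card,
    Fintype.card_fin] at h
  exact h

theorem rank_HZ : (binomialCode m N).HZ.rank = (binomialCode m N).HX.rank := by
  rw [HZ_eq_submatrix, Matrix.rank_submatrix]

theorem two_add_rank_add_rank (hm : 1 ≤ m) (hmN : m < N) :
    2 + (binomialCode m N).HX.rank + (binomialCode m N).HZ.rank = 2 * N := by
  have := rank_HX hm hmN
  rw [rank_HZ]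
  omega

theorem minDist_eq_distX : (binomialCode m N).minDist = (binomialCode m N).distX := by
  rw [CSSCode.minDist, CSSCode.distZ_eq_distX _ _ _ HX_eq_submatrix HZ_eq_submatrix, min_self]

/-! ### Translates of cocycles and the counting bound -/

/-- The translate of a vector by `g` in the cyclic group of order `N`. -/
def translate (g : Fin N) (z : Fin N ⊕ Fin N → ZMod 2) : Fin N ⊕ Fin N → ZMod 2 :=
  z ∘ Sum.map (· + g) (· + g)

theorem HZ_mulVec_translate (hm : 1 ≤ m) (hmN : m < N) {z : Fin N ⊕ Fin N → ZMod 2}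
    (hz : (binomialCode m N).HZ.mulVec z = 0) (g : Fin N) :
    (binomialCode m N).HZ.mulVec (translate g z) = 0 := by
  ext i
  have := congrFun hz (i + g)
  rw [HZ_mulVec hm hmN] at this ⊢
  simp only [translate, Function.comp_apply, Sum.map_inl, Sum.map_inr]
  rw [add_right_comm i g, add_right_comm i g] at this
  exact this

theorem dotProduct_translate (hm : 1 ≤ m) (hmN : m < N) {c z : Fin N ⊕ Fin N → ZMod 2}
    (hc : (binomialCode m N).HX.mulVec c = 0) (hz : (binomialCode m N).HZ.mulVec z = 0)
    (g : Fin N) : dotProduct (translate g z) c = dotProduct z c := by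
  induction g using induction_ofNat with
  | h0 => congr 1; ext i; rcases i with i | i <;> simp [translate]
  | h g ih =>
    rw [← ih, ← sub_eq_zero, ← sub_dotProduct]
    refine dotProduct_eq_zero_of_mem_rowSpace hc ?_
    -- Consecutive translates differ by the coboundary of the left half of `z`: on left edges by
    -- definition, on right edges by the cocycle condition.
    have := vecMul_mem_rowSpace (binomialCode m N).HX fun i => z (.inl (i + g))
    rw [vecMul_HX hm hmN] at this
    convert this using 1
    ext i
    rcases i with i | i
    · simp only [translate, Pi.sub_apply, Function.comp_apply, Sum.map_inl, Sum.elim_inl,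
        CharTwo.sub_eq_add]
      rw [add_comm, add_right_comm i, add_assoc i]
    · have h := congrFun (HZ_mulVec_translate hm hmN hz g) i
      rw [HZ_mulVec hm hmN] at h
      simp only [translate, Pi.sub_apply, Function.comp_apply, Sum.map_inl, Sum.map_inr,
        Sum.elim_inr, Pi.zero_apply, CharTwo.sub_eq_add] at h ⊢
      rw [CharTwo.add_eq_zero] at h
      rw [h, add_comm, add_right_comm i, add_assoc i]

/-- Double counting: each of the `N` translates of `z` meets the support of `c`, and each edge lies
in at most `w` translates. -/
theorem card_le_mul_hammingNorm (hm : 1 ≤ m) (hmN : m < N) {c z : Fin N ⊕ Fin N → ZMod 2}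
    (hc : (binomialCode m N).HX.mulVec c = 0) (hz : (binomialCode m N).HZ.mulVec z = 0)
    (hcz : dotProduct z c ≠ 0) {w : ℕ} (hl : hammingNorm (fun i => z (.inl i)) ≤ w)
    (hr : hammingNorm (fun i => z (.inr i)) ≤ w) : N ≤ w * hammingNorm c := by
  classical
  let S : Finset (Fin N ⊕ Fin N) := {j | c j ≠ 0}
  let T (j : Fin N ⊕ Fin N) : Finset (Fin N) := {g | translate g z j ≠ 0}
  have hT : ∀ j, (T j).card ≤ w := by
    rintro (j | j)
    · refine le_trans (le_of_eq ?_) hl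
      exact Finset.card_equiv (Equiv.addLeft j) fun g => by
        rw [Finset.mem_filter, Finset.mem_filter]
        simp [translate]
    · refine le_trans (le_of_eq ?_) hr
      exact Finset.card_equiv (Equiv.addLeft j) fun g => by
        rw [Finset.mem_filter, Finset.mem_filter]
        simp [translate]
  have hcover : (Finset.univ : Finset (Fin N)) ⊆ S.biUnion T := by
    intro g _
    rw [← dotProduct_translate hm hmN hc hz g] at hcz
    obtain ⟨j, _, hj⟩ := Finset.exists_ne_zero_of_sum_ne_zero hcz
    exact Finset.mem_biUnion.2 ⟨j, by simpa [S] using right_ne_zero_of_mul hj,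
      by simpa [T] using left_ne_zero_of_mul hj⟩
  calc N = (Finset.univ : Finset (Fin N)).card := by simp
    _ ≤ (S.biUnion T).card := Finset.card_le_card hcover
    _ ≤ S.card * w := Finset.card_biUnion_le_card_mul _ _ _ fun j _ => hT j
    _ = w * hammingNorm c := mul_comm _ _

/-! ### Cocycles of small weight from floor functions -/

theorem periodic_apply_val_ofNat {α : Type*} {f : ℤ → α} (hf : Function.Periodic f N) (k : ℕ) :
    f ((Fin.ofNat N k : Fin N) : ℕ) = f k := by
  rw [Fin.val_ofNat, Int.natCast_mod, Int.emod_def, mul_comm]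
  simpa using hf.sub_int_mul_eq (x := (k : ℤ)) ((k : ℤ) / N)

theorem periodic_apply_val_add {α : Type*} {f : ℤ → α} (hf : Function.Periodic f N)
    (i : Fin N) (k : ℕ) : f ((i + Fin.ofNat N k : Fin N) : ℕ) = f ((i : ℕ) + k) := by
  have : i + Fin.ofNat N k = Fin.ofNat N (i + k) := by rw [ofNat_add, Fin.ofNat_val_eq_self]
  rw [this, periodic_apply_val_ofNat hf]
  push_cast
  rfl

/-- The increment over `s` steps of `x ↦ ⌊q x / N⌋`, corrected by `k`. -/
def floorJump (N : ℕ) (q k : ℤ) (s : ℕ) (x : ℤ) : ℤ := (x + s) * q / N - x * q / N - k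

theorem floorJump_periodic (q k : ℤ) (s : ℕ) : Function.Periodic (floorJump N q k s) N := by
  intro x
  have hN : (N : ℤ) ≠ 0 := by exact_mod_cast NeZero.ne N
  have h1 : (x + N + s) * q = (x + s) * q + q * N := by ring
  have h2 : (x + N) * q = x * q + q * N := by ring
  simp only [floorJump, h1, h2, Int.add_mul_ediv_right _ _ hN]
  ring

/-- All increments have the same sign. -/
theorem floorJump_nonneg_or_nonpos (q k : ℤ) (s : ℕ) :
    (∀ x, 0 ≤ floorJump N q k s x) ∨ ∀ x, floorJump N q k s x ≤ 0 := by
  have hN : (0 : ℤ) < N := by exact_mod_cast NeZero.pos N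
  have h : ∀ x, floorJump N q k s x = (x * q + (s * q - k * N)) / N - x * q / N := by
    intro x
    have : (x + s) * q = x * q + (s * q - k * N) + k * N := by ring
    rw [floorJump, this, Int.add_mul_ediv_right _ _ hN.ne']
    ring
  rcases le_total 0 (s * q - k * N) with h0 | h0
  · left
    intro x
    rw [h, sub_nonneg]
    exact Int.ediv_le_ediv hN (by linarith)
  · right
    intro x
    rw [h, sub_nonpos]
    exact Int.ediv_le_ediv hN (by linarith)

theorem sum_floorJump (q k : ℤ) (s : ℕ) :
    ∑ x : Fin N, floorJump N q k s (x : ℕ) = s * q - k * N := by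
  have hN : (N : ℤ) ≠ 0 := by exact_mod_cast NeZero.ne N
  rw [Fin.sum_univ_eq_sum_range (fun x : ℕ => floorJump N q k s x)]
  simp only [floorJump, Finset.sum_sub_distrib _ (fun _ => k)]
  rw [sum_apply_add_sub (f := fun x => x * q / N) (a := q)]
  · simp [mul_comm]
  · intro x
    rw [add_mul, mul_comm (N : ℤ) q, Int.add_mul_ediv_right _ _ hN]

/-- Each nonzero entry comes from a jump of size at least one, and since the jumps share a sign,
their absolute values add up to the absolute value of the total. -/
theorem hammingNorm_floorJump_le (q k : ℤ) (s : ℕ) {w : ℕ} (hw : |s * q - k * N| ≤ w) :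
    hammingNorm (fun x : Fin N => (floorJump N q k s (x : ℕ) : ZMod 2)) ≤ w := by
  classical
  have h1 : (hammingNorm (fun x : Fin N => (floorJump N q k s (x : ℕ) : ZMod 2)) : ℤ) ≤
      ∑ x : Fin N, |floorJump N q k s (x : ℕ)| := by
    rw [hammingNorm, Finset.card_filter]
    push_cast
    refine Finset.sum_le_sum fun x _ => ?_
    split_ifs with h
    · refine Int.one_le_abs fun h0 => h ?_
      rw [h0, Int.cast_zero]
    · exact abs_nonneg _
  have h2 : ∑ x : Fin N, |floorJump N q k s (x : ℕ)| = |s * q - k * N| := by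
    rw [← sum_floorJump]
    rcases floorJump_nonneg_or_nonpos (N := N) q k s with h | h
    · rw [abs_of_nonneg (Finset.sum_nonneg fun _ _ => h _)]
      exact Finset.sum_congr rfl fun _ _ => abs_of_nonneg (h _)
    · rw [abs_of_nonpos (Finset.sum_nonpos fun _ _ => h _), ← Finset.sum_neg_distrib]
      exact Finset.sum_congr rfl fun _ _ => abs_of_nonpos (h _)
  exact_mod_cast (h1.trans h2.le).trans hw

/-- The vector whose entries are the parities of the jumps of `x ↦ ⌊q x / N⌋` along the steps of
lengths `1` and `m`, the latter corrected by `k`. -/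
def cocycle (m N : ℕ) (q k : ℤ) : Fin N ⊕ Fin N → ZMod 2 :=
  Sum.elim (fun x => (floorJump N q 0 1 (x : ℕ) : ZMod 2))
    fun x => (floorJump N q k m (x : ℕ) : ZMod 2)

/-- The floor function is not periodic, but its increments are. Around a square they cancel, and the
correction `k` enters on two opposite edges. -/
theorem HZ_mulVec_cocycle (hm : 1 ≤ m) (hmN : m < N) (q k : ℤ) :
    (binomialCode m N).HZ.mulVec (cocycle m N q k) = 0 := by
  ext i
  rw [HZ_mulVec hm hmN]
  simp only [cocycle, Sum.elim_inl, Sum.elim_inr, periodic_apply_val_add (floorJump_periodic _ _ _),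
    Pi.zero_apply]
  have : floorJump N q 0 1 (i : ℕ) + floorJump N q k m ((i : ℕ) + (1 : ℕ)) =
      floorJump N q 0 1 ((i : ℕ) + m) + floorJump N q k m (i : ℕ) := by
    simp only [floorJump, add_right_comm _ (m : ℤ) ((1 : ℕ) : ℤ)]
    ring
  have := congrArg (Int.cast : ℤ → ZMod 2) this
  push_cast at this
  have hsum : ∀ a b c d : ZMod 2, a + d = b + c → a + b + (c + d) = 0 := by decide
  exact hsum _ _ _ _ (by exact_mod_cast this)

/-! ### Closed paths and their pairing with cocycles -/

/-- The closed path from `0` that makes `P` steps of length `1` and then `Q` steps of length `m`. -/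
def path (m N P Q : ℕ) [NeZero N] : Fin N ⊕ Fin N → ZMod 2 :=
  ∑ i ∈ Finset.range P, Pi.single (.inl (Fin.ofNat N i)) 1 +
    ∑ j ∈ Finset.range Q, Pi.single (.inr (Fin.ofNat N (P + m * j))) 1

theorem HX_mulVec_single_inl (hm : 1 ≤ m) (hmN : m < N) (k : ℕ) :
    (binomialCode m N).HX.mulVec (Pi.single (.inl (Fin.ofNat N k)) 1) =
      Pi.single (Fin.ofNat N (k + 1)) 1 - Pi.single (Fin.ofNat N k) 1 := by
  ext i
  rw [HX_mulVec hm hmN, ofNat_add, CharTwo.sub_eq_add]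
  simp [Pi.single_apply, sub_eq_iff_eq_add, add_comm]

theorem HX_mulVec_single_inr (hm : 1 ≤ m) (hmN : m < N) (k : ℕ) :
    (binomialCode m N).HX.mulVec (Pi.single (.inr (Fin.ofNat N k)) 1) =
      Pi.single (Fin.ofNat N (k + m)) 1 - Pi.single (Fin.ofNat N k) 1 := by
  ext i
  rw [HX_mulVec hm hmN, ofNat_add, CharTwo.sub_eq_add]
  simp [Pi.single_apply, sub_eq_iff_eq_add, add_comm]

theorem HX_mulVec_path (hm : 1 ≤ m) (hmN : m < N) {P Q l : ℕ} (h : P + m * Q = l * N) :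
    (binomialCode m N).HX.mulVec (path m N P Q) = 0 := by
  have h1 := Finset.sum_range_sub
    (fun i : ℕ => (Pi.single (Fin.ofNat N i) 1 : Fin N → ZMod 2)) P
  have h2 := Finset.sum_range_sub
    (fun i : ℕ => (Pi.single (Fin.ofNat N (P + m * i)) 1 : Fin N → ZMod 2)) Q
  rw [path, Matrix.mulVec_add, Matrix.mulVec_sum, Matrix.mulVec_sum]
  simp only [HX_mulVec_single_inl hm hmN, HX_mulVec_single_inr hm hmN]
  simp only [mul_add, mul_one, mul_zero, add_zero, ← add_assoc] at h2
  rw [h1, h2, h]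
  have : Fin.ofNat N (l * N) = Fin.ofNat N 0 := by ext; simp
  rw [this]
  abel

/-- The jumps telescope along the path to `⌊q l N / N⌋ = l q`, and each of the `Q` long steps
subtracts `k`. -/
theorem path_dotProduct_cocycle {P Q l : ℕ} (h : P + m * Q = l * N) (q k : ℤ) :
    dotProduct (path m N P Q) (cocycle m N q k) = l * q - Q * k := by
  have hN : (N : ℤ) ≠ 0 := by exact_mod_cast NeZero.ne N
  have h1 := Finset.sum_range_sub (fun i : ℕ => (i : ℤ) * q / N) P
  have h2 := Finset.sum_range_sub (fun j : ℕ => ((P + m * j : ℕ) : ℤ) * q / N) Q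
  have h3 : ((P + m * Q : ℕ) : ℤ) * q / N = l * q := by
    rw [h, Nat.cast_mul, mul_right_comm, Int.mul_ediv_cancel _ hN]
  rw [path, add_dotProduct, sum_dotProduct, sum_dotProduct]
  simp only [single_dotProduct, one_mul, cocycle, Sum.elim_inl, Sum.elim_inr,
    periodic_apply_val_ofNat (floorJump_periodic _ _ _)]
  rw [← Int.cast_sum, ← Int.cast_sum, ← Int.cast_add]
  have : ∑ i ∈ Finset.range P, floorJump N q 0 1 i +
      ∑ j ∈ Finset.range Q, floorJump N q k m (P + m * j : ℕ) = l * q - Q * k := by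
    rw [h3] at h2
    simp only [floorJump, Finset.sum_sub_distrib _ (fun _ => k), sub_zero]
    push_cast at h1 h2 ⊢
    simp only [mul_add, mul_one, mul_zero, add_zero, ← add_assoc] at h2
    rw [h1, h2, zero_mul, Int.zero_ediv, Finset.sum_const, Finset.card_range, nsmul_eq_mul]
    ring
  rw [this]
  push_cast
  rfl

theorem hammingNorm_single_le {ι : Type*} [Fintype ι] [DecidableEq ι] (j : ι) :
    hammingNorm (Pi.single j 1 : ι → ZMod 2) ≤ 1 := by
  rw [hammingNorm, Finset.card_le_one]
  intro a ha b hb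
  simp only [Pi.single_apply, Finset.mem_filter] at ha hb
  rw [show a = j by by_contra h; simp [h] at ha, show b = j by by_contra h; simp [h] at hb]

theorem hammingNorm_add_le {ι : Type*} [Fintype ι] (a b : ι → ZMod 2) :
    hammingNorm (a + b) ≤ hammingNorm a + hammingNorm b := by
  have := hammingDist_triangle (a + b) b 0
  rw [hammingDist_zero_right, hammingDist_zero_right, hammingDist_eq_hammingNorm, neg_add,
    neg_add_cancel_right, show -a = a from funext fun _ => CharTwo.neg_eq _] at this
  exact this

theorem hammingNorm_sum_single_le {ι : Type*} [Fintype ι] [DecidableEq ι] (f : ℕ → ι) (P : ℕ) :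
    hammingNorm (∑ i ∈ Finset.range P, (Pi.single (f i) 1 : ι → ZMod 2)) ≤ P := by
  induction P with
  | zero => simp
  | succ P ih =>
    rw [Finset.sum_range_succ]
    exact (hammingNorm_add_le _ _).trans (add_le_add ih (hammingNorm_single_le _))

theorem hammingNorm_path_le (m P Q : ℕ) : hammingNorm (path m N P Q) ≤ P + Q :=
  (hammingNorm_add_le _ _).trans
    (add_le_add (hammingNorm_sum_single_le _ P) (hammingNorm_sum_single_le _ Q))

/-! ### The distance criterion and the parity of cycles -/

/-- If two cocycles with odd determinant have few nonzero entries of each kind, the minimum distance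
is the length of a shortest closed path. -/
theorem hasParameters_of_cocycles (hm : 1 ≤ m) (hmN : m < N) {w P Q : ℕ} {q₁ k₁ q₂ k₂ : ℤ}
    (hdet : Odd (q₁ * k₂ - q₂ * k₁)) (hq₁ : |q₁| ≤ w) (hq₂ : |q₂| ≤ w)
    (hp₁ : |m * q₁ - k₁ * N| ≤ w) (hp₂ : |m * q₂ - k₂ * N| ≤ w) (hPQ : P + m * Q = N)
    (hdist : ∀ c, (binomialCode m N).HX.mulVec c = 0 → N ≤ w * hammingNorm c →
      P + Q ≤ hammingNorm c) :
    (binomialCode m N).HasParameters (2 * N) 2 (P + Q) := by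
  have hcard : Fintype.card (Fin N ⊕ Fin N) = 2 * N := by
    rw [Fintype.card_sum, Fintype.card_fin, two_mul]
  have hlog := two_add_rank_add_rank hm hmN
  have hdet' : (q₁ * k₂ - q₂ * k₁ : ZMod 2) = 1 := by
    exact_mod_cast ZMod.intCast_eq_one_iff_odd.2 hdet
  have hz₁ := HZ_mulVec_cocycle hm hmN q₁ k₁
  have hz₂ := HZ_mulVec_cocycle hm hmN q₂ k₂
  refine ⟨hcard, CSSCode.finrank_codeSpace _ (hlog.trans hcard.symm), hlog, ?_⟩
  rw [minDist_eq_distX]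
  have hPQ' : P + m * Q = 1 * N := by rw [hPQ, one_mul]
  refine CSSCode.distX_eq _ _ (HX_mulVec_path hm hmN hPQ') ?_ (hammingNorm_path_le m P Q) ?_
  · intro hmem
    have h1 := dotProduct_eq_zero_of_mem_rowSpace hz₁ hmem
    have h2 := dotProduct_eq_zero_of_mem_rowSpace hz₂ hmem
    rw [path_dotProduct_cocycle hPQ'] at h1 h2
    -- If both pairings vanish, then `qᵢ = Q * kᵢ` mod 2, which makes the determinant even.
    generalize (q₁ : ZMod 2) = a₁, (q₂ : ZMod 2) = a₂, (k₁ : ZMod 2) = b₁, (k₂ : ZMod 2) = b₂,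
      (Q : ZMod 2) = x at h1 h2 hdet'
    rw [Nat.cast_one] at h1 h2
    revert a₁ a₂ b₁ b₂ x
    decide
  · intro c hc hcmem
    have hsmall : ∀ q k : ℤ, |q| ≤ w → |m * q - k * N| ≤ w →
        dotProduct c (cocycle m N q k) ≠ 0 → P + Q ≤ hammingNorm c := by
      intro q k hq hp h
      rw [dotProduct_comm] at h
      refine hdist c hc (card_le_mul_hammingNorm hm hmN hc (HZ_mulVec_cocycle hm hmN q k) h ?_ ?_)
      · exact hammingNorm_floorJump_le q 0 1 (by simpa using hq)
      · exact hammingNorm_floorJump_le q k m hp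
    by_contra hlt
    refine hcmem (CSSCode.mem_rowSpace_HZ_of_dotProduct_eq_zero _ (hlog.trans hcard.symm) hz₁ hz₂
      ?_ hc (by_contra fun h => hlt (hsmall _ _ hq₁ hp₁ h))
      (by_contra fun h => hlt (hsmall _ _ hq₂ hp₂ h)))
    intro a b
    -- Closed paths realize every pair of values. The shift by `2` keeps the parity of the winding
    -- number and leaves room for a nonnegative number of unit steps.
    have hsol : ∀ a₁ b₁ a₂ b₂ a b : ZMod 2, a₁ * b₂ - a₂ * b₁ = 1 →
        ∃ l Q : Fin 2, (l + 2 : ℕ) * a₁ - (Q : ℕ) * b₁ = a ∧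
          (l + 2 : ℕ) * a₂ - (Q : ℕ) * b₂ = b := by
      decide
    obtain ⟨l, Q', h₁, h₂⟩ := hsol q₁ k₁ q₂ k₂ a b hdet'
    have hle : m * Q' ≤ (l + 2) * N := by
      have : (Q' : ℕ) ≤ 1 := by omega
      nlinarith
    have hpath : ((l + 2) * N - m * Q') + m * Q' = (l + 2) * N := Nat.sub_add_cancel hle
    refine ⟨path m N ((l + 2) * N - m * Q') Q', HX_mulVec_path hm hmN hpath, ?_, ?_⟩
    · rw [path_dotProduct_cocycle hpath]
      exact h₁
    · rw [path_dotProduct_cocycle hpath]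
      exact h₂

/-- For even `N` and odd `m` the sum of the rows of `HX` of even index is the all-ones vector. -/
theorem even_hammingNorm (hm : 1 ≤ m) (hmN : m < N) (hN : Even N) (hmo : Odd m)
    {c : Fin N ⊕ Fin N → ZMod 2} (hc : (binomialCode m N).HX.mulVec c = 0) :
    Even (hammingNorm c) := by
  classical
  have hper : Function.Periodic (fun x : ℤ => (x : ZMod 2)) N := by
    intro x
    push_cast
    rw [ZMod.natCast_eq_zero_iff_even.2 hN, add_zero]
  -- The parity of a vertex is well defined because `N` is even, and it changes along every edge
  -- because `1` and `m` are odd.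
  have hrow := vecMul_mem_rowSpace (binomialCode m N).HX fun i => (((i : ℕ) : ℤ) : ZMod 2)
  have hones : (binomialCode m N).HX.vecMul (fun i : Fin N => (((i : ℕ) : ℤ) : ZMod 2)) =
      fun _ => 1 := by
    rw [vecMul_HX hm hmN]
    have hmo' : (m : ZMod 2) = 1 := ZMod.natCast_eq_one_iff_odd.2 hmo
    have key : ∀ s : ℕ, (s : ZMod 2) = 1 → ∀ i : Fin N, (((i : ℕ) : ℤ) : ZMod 2) +
        (((i + Fin.ofNat N s : Fin N) : ℕ) : ℤ) = 1 := by
      intro s hs i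
      rw [periodic_apply_val_add hper]
      push_cast
      rw [← add_assoc, CharTwo.add_self_eq_zero, zero_add, hs]
    ext i
    rcases i with i | i
    · exact key 1 Nat.cast_one i
    · exact key m hmo' i
  rw [hones] at hrow
  have h := dotProduct_eq_zero_of_mem_rowSpace hc hrow
  rw [← ZMod.natCast_eq_zero_iff_even, ← h, hammingNorm, Finset.card_filter]
  simp only [dotProduct, one_mul]
  push_cast
  refine Finset.sum_congr rfl fun i _ => ?_
  have : ∀ a : ZMod 2, (if a ≠ 0 then 1 else 0) = a := by decide
  convert this (c i)

/-! ### The three families -/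

theorem hasParameters_square {n : ℕ} (hn : 2 ≤ n) :
    (binomialCode n (n ^ 2)).HasParameters (2 * n ^ 2) 2 n := by
  have : NeZero (n ^ 2) := ⟨by positivity⟩
  -- The bounds on the left and right weights of the two cocycles are `(1, n)` and `(n, 0)`.
  have h := hasParameters_of_cocycles (m := n) (N := n ^ 2) (w := n) (P := 0) (Q := n)
    (q₁ := -1) (k₁ := 0) (q₂ := n) (k₂ := 1) (by omega) (by nlinarith) (by simp)
    (by simp; omega) (by simp) (by simp) (by simp [pow_two]) (by ring)
    (fun c _ h => by nlinarith)
  rwa [zero_add] at h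

theorem hasParameters_two_mul_square {r : ℕ} (hr : 1 ≤ r) :
    (binomialCode (2 * r - 1) (2 * r ^ 2)).HasParameters (4 * r ^ 2) 2 (2 * r) := by
  have : NeZero (2 * r ^ 2) := ⟨by positivity⟩
  have hcast : ((2 * r - 1 : ℕ) : ℤ) = 2 * r - 1 := by omega
  have hmN : 2 * r - 1 < 2 * r ^ 2 := by
    have : r ≤ r ^ 2 := Nat.le_self_pow two_ne_zero r
    omega
  -- The weight bounds are `(r, r)` and `(r + 1, r - 1)`.
  have h := hasParameters_of_cocycles (m := 2 * r - 1) (N := 2 * r ^ 2) (w := r + 1) (P := r)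
    (Q := r) (q₁ := r) (k₁ := 1) (q₂ := -(r + 1)) (k₂ := -1) (by omega) hmN
    (by ring_nf; decide) (by rw [abs_le]; push_cast; constructor <;> linarith)
    (by rw [abs_le]; push_cast; constructor <;> linarith)
    (by rw [hcast, abs_le]; push_cast; constructor <;> nlinarith)
    (by rw [hcast, abs_le]; push_cast; constructor <;> nlinarith)
    (by zify [show 1 ≤ 2 * r by omega]; ring)
    -- Counting excludes only weights up to `2r - 2`, as `2(r + 1)(r - 1) < 2r²`; evenness of the
    -- weight excludes `2r - 1`.
    (fun c hc h => by
      obtain ⟨s, hs⟩ := even_hammingNorm (by omega) hmN (even_two_mul _)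
        (by rw [Nat.odd_iff]; omega) hc
      rw [hs] at h ⊢
      have : r ≤ s := by
        by_contra hlt
        obtain ⟨u, rfl⟩ : ∃ u, r = s + 1 + u := ⟨r - (s + 1), by omega⟩
        nlinarith
      omega)
  convert h using 1 <;> ring

theorem hasParameters_sum_two_squares {t : ℕ} (ht : 1 ≤ t) :
    (binomialCode (2 * t + 1) (t ^ 2 + (t + 1) ^ 2)).HasParameters
      ((2 * t + 1) ^ 2 + 1) 2 (2 * t + 1) := by
  have : NeZero (t ^ 2 + (t + 1) ^ 2) := ⟨by positivity⟩
  -- The weight bounds are `(t, t + 1)` and `(t + 1, t)`. Since `N = 2t(t + 1) + 1`, counting alone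
  -- excludes weight `2t`.
  have h := hasParameters_of_cocycles (m := 2 * t + 1) (N := t ^ 2 + (t + 1) ^ 2) (w := t + 1)
    (P := t + 1) (Q := t) (q₁ := t) (k₁ := 1) (q₂ := t + 1) (k₂ := 1) (by omega) (by nlinarith)
    (by ring_nf; decide) (by rw [abs_le]; push_cast; constructor <;> linarith)
    (by rw [abs_le]; push_cast; constructor <;> linarith)
    (by rw [abs_le]; push_cast; constructor <;> nlinarith)
    (by rw [abs_le]; push_cast; constructor <;> nlinarith)
    (by ring)
    (fun c _ h => by
      by_contra hlt
      have : hammingNorm c ≤ 2 * t := by omega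
      nlinarith [Nat.mul_le_mul_left (t + 1) this])
  convert h using 1 <;> ring

end GB

theorem mainTheorem3 :
    (∀ n : ℕ, 2 ≤ n →
      (GB (1 + X) (1 + X ^ n) (n ^ 2)).HasParameters (2 * n ^ 2) 2 n) ∧
    (∀ r : ℕ, 1 ≤ r →
      (GB (1 + X) (1 + X ^ (2 * r - 1)) (2 * r ^ 2)).HasParameters (4 * r ^ 2) 2 (2 * r)) ∧
    (∀ t : ℕ, 1 ≤ t →
      (GB (1 + X) (1 + X ^ (2 * t + 1)) (t ^ 2 + (t + 1) ^ 2)).HasParameters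
        ((2 * t + 1) ^ 2 + 1) 2 (2 * t + 1)) :=
  ⟨fun _ => GB.hasParameters_square, fun _ => GB.hasParameters_two_mul_square,
    fun _ => GB.hasParameters_sum_two_squares⟩
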